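/- Let $M$ be a (Hausdorff) smooth manifold of dimension $n\ge 2$, let $p\in M$, and let $\Omega^{\mathrm{ps}}(M,p)$ be the set of piecewise-smooth loops based at $p$, i.e. continuous maps $\gamma:[0,1]\to M$ with $\gamma(0)=\gamma(1)=p$ for which there is a partition $0=t_0<\dots<t_r=1$ such that every restriction $\gamma|_{[t_{i-1},t_i]}$ is smooth. Give $\Omega^{\mathrm{ps}}(M,p)$ the compact-open topology (equivalently, when the topology of $M$ is given by a metric $d$, the topology of the metric $\sup_{t}d(\gamma(t),\gamma'(t))$). Write $\sigma_2\cdot\sigma_1$ for the concatenation that runs first through $\sigma_1$ and then through $\sigma_2$, and $\sigma^{-1}(t)=\sigma(1-t)$. Let $\sim_{\mathrm{ret}}$ (retrace equivalence) be the equivalence relation on $\Omega^{\mathrm{ps}}(M,p)$ generated by 1. generalized reparametrizations: $\gamma\sim\gamma\circ\phi$ whenever $\gamma,\gamma\circ\phi\in\Omega^{\mathrm{ps}}(M,p)$ and $\phi:[0,1]\to[0,1]$ is continuous and piecewise smooth with $\phi(0)=0$, $\phi(1)=1$ and $0<\phi(t)<1$ for $0<t<1$; 2. retracings: $\alpha_2\cdot\beta^{-1}\cdot\beta\cdot\alpha_1\sim\alpha_2\cdot\alpha_1$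 for all piecewise-smooth paths $\alpha_1,\alpha_2,\beta$ in $M$ with $\alpha_1(0)=\alpha_2(1)=p$ and $\alpha_1(1)=\alpha_2(0)=\beta(0)$, where $\alpha_1$ or $\alpha_2$ may also be absent, i.e. $\alpha_2\cdot\beta^{-1}\cdot\beta\sim\alpha_2$ and $\beta^{-1}\cdot\beta\cdot\alpha_1\sim\alpha_1$ are included. (The bracketing of the concatenations is irrelevant because of 1.) Then the quotient $\mathcal{L}^{\mathrm{ret}}(M,p)=\Omega^{\mathrm{ps}}(M,p)/\!\sim_{\mathrm{ret}}$, with the quotient topology, is not Hausdorff. -/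

import Mathlib

open scoped Manifold ContDiff unitInterval

namespace LoopGroup

section

variable {E H M : Type*} [NormedAddCommGroup E] [NormedSpace ℝ E] [TopologicalSpace H]
  [TopologicalSpace M] [ChartedSpace H M]

/-- `f` is piecewise smooth on `[0,1]`: there is a partition `0 = t₀ < ⋯ < t_r = 1` such that `f`
is smooth on each closed interval `[t_{i-1}, t_i]`. Only the values of `f` on `[0,1]` matter. -/
def PiecewiseSmooth (J : ModelWithCorners ℝ E H) (f : ℝ → M) : Prop :=
  ∃ (r : ℕ) (t : Fin (r + 1) → ℝ), StrictMono t ∧ t 0 = 0 ∧ t (Fin.last r) = 1 ∧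
    ∀ i : Fin r, ContMDiffOn 𝓘(ℝ, ℝ) J ∞ f (Set.Icc (t i.castSucc) (t i.succ))

/-- A (continuous) path in `M` that is piecewise smooth. -/
def IsPSPath (J : ModelWithCorners ℝ E H) {x y : M} (γ : Path x y) : Prop :=
  PiecewiseSmooth J γ.extend

/-- A generalized reparametrization: a continuous piecewise-smooth `φ : [0,1] → [0,1]` with
`φ 0 = 0`, `φ 1 = 1` and `0 < φ t < 1` for `0 < t < 1` (not necessarily monotone). -/
structure IsGenReparam (φ : I → I) : Prop where
  continuous : Continuous φ
  piecewiseSmooth :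
    PiecewiseSmooth 𝓘(ℝ, ℝ) (fun s : ℝ => (φ (Set.projIcc 0 1 zero_le_one s) : ℝ))
  map_zero : φ 0 = 0
  map_one : φ 1 = 1
  mem_interior : ∀ t : I, 0 < t → t < 1 → 0 < φ t ∧ φ t < 1

/-- `IsRetracing J γ' γ`: the loop `γ` arises from `γ'` by deleting a portion `β` followed by
its inverse, with `β` a piecewise-smooth path. `σ.trans τ` runs first through `σ`, then
through `τ`. The constructor `middle` is the case of two complementary paths `α₁`, `α₂`;
`start` and `finish` are the cases in which `α₁`, respectively `α₂`, is the empty path. -/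
inductive IsRetracing (J : ModelWithCorners ℝ E H) {p : M} : Path p p → Path p p → Prop
  | middle {q r : M} (α₁ : Path p q) (β : Path q r) (α₂ : Path q p)
      (h₁ : IsPSPath J α₁) (hβ : IsPSPath J β) (h₂ : IsPSPath J α₂) :
      IsRetracing J ((α₁.trans (β.trans β.symm)).trans α₂) (α₁.trans α₂)
  | start {r : M} (β : Path p r) (α : Path p p) (hβ : IsPSPath J β) (hα : IsPSPath J α) :
      IsRetracing J ((β.trans β.symm).trans α) α
  | finish {r : M} (α : Path p p) (β : Path p r) (hα : IsPSPath J α) (hβ : IsPSPath J β) :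
      IsRetracing J (α.trans (β.trans β.symm)) α

/-- The space `Ω^ps(M,p)` of piecewise-smooth loops based at `p`, with the compact-open topology
(the subspace topology from `Path p p`, which is a subspace of `C([0,1], M)`). -/
abbrev PSLoop (J : ModelWithCorners ℝ E H) (p : M) : Type _ :=
  {γ : Path p p // IsPSPath J γ}

/-- An elementary step: a generalized reparametrization or a retracing. -/
def RetStep (J : ModelWithCorners ℝ E H) {p : M} (γ₀ γ₁ : PSLoop J p) : Prop :=
  (∃ φ : I → I, IsGenReparam φ ∧ ∀ t : I, γ₁.1 t = γ₀.1 (φ t)) ∨ IsRetracing J γ₀.1 γ₁.1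

/-- Retrace equivalence: a finite number of retracings (in either direction) and generalized
reparametrizations. -/
def retSetoid (J : ModelWithCorners ℝ E H) (p : M) : Setoid (PSLoop J p) :=
  Relation.EqvGen.setoid (RetStep J)

/-- The quotient `L^ret(M,p)` of `Ω^ps(M,p)` by retrace equivalence; as an abbreviation for a
`Quotient` of a topological space it carries the quotient topology. -/
abbrev LRet (J : ModelWithCorners ℝ E H) (p : M) : Type _ :=
  Quotient (retSetoid J p)

end

end LoopGroup

/-! In a chart at `p`, choose vectors `v k`, no two on a line through the origin, with norms
decaying factorially. Let `L m` run out to `v m` along a segment and back, then out to `v (m+1)` and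
back, and so on, on dyadically shrinking time intervals; factorial decay makes `L m` smooth.
Removing the first excursion is a single retracing, so all `L m` lie in one class, while `L m`
converges to the constant loop. In a Hausdorff quotient `L 0` would then be equivalent to the
constant loop.

An invariant excludes this. Let `q k` be the tip of the `k`-th excursion, and count modulo 2 the
time intervals between consecutive visits to the set of tips that lead from `q k` to `q (k+1)` or
back. A concatenation adds these counts except for finitely many `k` (`ncard_gaps_split`), a path
and its reverse contribute equally and cancel, and a reparametrization covers each such interval an
odd number of times (`ncard_gaps_comp`, by `odd_ncard_crossings`). Hence the parities are invariant
for all large `k` (`gapParity_eventuallyEq_of_retSetoid`). They are all 1 for `L 0` and all 0 for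
the constant loop. -/

open Set Filter Topology

namespace LoopGroup

/-! ### Gaps between visits to a sequence of points -/

section Gaps

variable {M : Type*}

/-- The pairs `s < t` in `[a,b]` such that `g` takes the values `q k` and `q (k+1)`, in either
order, at `s` and `t`, and takes none of the values `q j` strictly between. -/
def gaps (q : ℕ → M) (k : ℕ) (g : ℝ → M) (a b : ℝ) : Set (ℝ × ℝ) :=
  {x | a ≤ x.1 ∧ x.1 < x.2 ∧ x.2 ≤ b ∧
    (g x.1 = q k ∧ g x.2 = q (k + 1) ∨ g x.1 = q (k + 1) ∧ g x.2 = q k) ∧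
    ∀ u ∈ Ioo x.1 x.2, ∀ j, g u ≠ q j}

theorem gaps_left_visit {q : ℕ → M} {k : ℕ} {g : ℝ → M} {a b : ℝ} {x : ℝ × ℝ}
    (hx : x ∈ gaps q k g a b) : ∃ j, g x.1 = q j := by
  rcases hx.2.2.2.1 with h | h
  exacts [⟨_, h.1⟩, ⟨_, h.1⟩]

theorem gaps_right_visit {q : ℕ → M} {k : ℕ} {g : ℝ → M} {a b : ℝ} {x : ℝ × ℝ}
    (hx : x ∈ gaps q k g a b) : ∃ j, g x.2 = q j := by
  rcases hx.2.2.2.1 with h | h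
  exacts [⟨_, h.2⟩, ⟨_, h.2⟩]

/-- Two gaps that share an interior point, or whose left end points lie in each other, agree. -/
theorem gaps_eq_of_overlap {q : ℕ → M} {k l : ℕ} {g : ℝ → M} {a b : ℝ} {x y : ℝ × ℝ}
    (hx : x ∈ gaps q k g a b) (hy : y ∈ gaps q l g a b) (h₁ : x.1 < y.2) (h₂ : y.1 < x.2) :
    x = y := by
  have key : ∀ {k l : ℕ} {x y : ℝ × ℝ}, x ∈ gaps q k g a b → y ∈ gaps q l g a b →
      y.1 < x.2 → x.1 < y.2 → ¬ x.1 < y.1 ∧ ¬ x.2 < y.2 := by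
    intro k l x y hx hy h₁ h₂
    refine ⟨fun h => ?_, fun h => ?_⟩
    · obtain ⟨j, hj⟩ := gaps_left_visit hy
      exact hx.2.2.2.2 _ ⟨h, h₁⟩ j hj
    · obtain ⟨j, hj⟩ := gaps_right_visit hx
      exact hy.2.2.2.2 _ ⟨h₁, h⟩ j hj
  obtain ⟨h3, h4⟩ := key hx hy h₂ h₁
  obtain ⟨h5, h6⟩ := key hy hx h₁ h₂
  exact Prod.ext (le_antisymm (not_lt.1 h5) (not_lt.1 h3)) (le_antisymm (not_lt.1 h6) (not_lt.1 h4))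

/-- The times in `[a,b]` spent at `q k` form a compact set disjoint from the closed set of times
spent at `q (k+1)`, so gaps are longer than some `δ > 0`. Two gaps whose left ends lie within `δ`
overlap and therefore agree. -/
theorem gaps_finite [TopologicalSpace M] [T1Space M] {q : ℕ → M} (hq : Function.Injective q)
    (k : ℕ) {g : ℝ → M} (hg : Continuous g) (a b : ℝ) : (gaps q k g a b).Finite := by
  have hdisj : Disjoint (Icc a b ∩ g ⁻¹' {q k}) (g ⁻¹' {q (k + 1)}) := by
    rw [Set.disjoint_left]
    rintro x ⟨-, hx⟩ hx'
    have := hq ((show g x = q k from hx).symm.trans hx')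
    omega
  obtain ⟨δ, hδ, hd⟩ := Metric.exists_pos_forall_lt_edist
    (isCompact_Icc.inter_right ((isClosed_singleton).preimage hg))
    ((isClosed_singleton (x := q (k + 1))).preimage hg) hdisj
  have hlen : ∀ x ∈ gaps q k g a b, (δ : ℝ) < x.2 - x.1 := by
    intro x hx
    have aux : ∀ y z : ℝ, (δ : ENNReal) < edist y z → (δ : ℝ) < |y - z| := by
      intro y z h
      rw [edist_nndist, ENNReal.coe_lt_coe] at h
      rw [← Real.dist_eq]
      exact_mod_cast h
    have hpos := hx.2.1
    rcases hx.2.2.2.1 with h | h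
    · have := aux _ _ (hd x.1 ⟨⟨hx.1, hpos.le.trans hx.2.2.1⟩, h.1⟩ x.2 h.2)
      rwa [abs_of_neg (by linarith), neg_sub] at this
    · have := aux _ _ (hd x.2 ⟨⟨hx.1.trans hpos.le, hx.2.2.1⟩, h.2⟩ x.1 h.1)
      rwa [abs_of_pos (by linarith)] at this
  have hδ' : (0 : ℝ) < δ := by exact_mod_cast hδ
  refine Set.Finite.of_finite_image (f := fun x : ℝ × ℝ => ⌊x.1 / δ⌋) ?_ ?_
  · refine (Set.finite_Icc ⌊a / δ⌋ ⌊b / δ⌋).subset ?_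
    rintro _ ⟨x, hx, rfl⟩
    exact ⟨Int.floor_le_floor (by gcongr; exact hx.1),
      Int.floor_le_floor (by gcongr; exact hx.2.1.le.trans hx.2.2.1)⟩
  · intro x hx y hy hxy
    have h := Int.abs_sub_lt_one_of_floor_eq_floor hxy
    rw [← sub_div, abs_div, abs_of_pos hδ', div_lt_one hδ', abs_lt] at h
    have h1 := hlen x hx
    have h2 := hlen y hy
    exact gaps_eq_of_overlap hx hy (by linarith) (by linarith)

theorem ncard_gaps_affine (q : ℕ → M) (k : ℕ) {g h : ℝ → M} {a b c d : ℝ} (hc : 0 < c)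
    (hgh : ∀ t ∈ Icc a b, h t = g (c * t + d)) :
    (gaps q k h a b).ncard = (gaps q k g (c * a + d) (c * b + d)).ncard := by
  have : gaps q k g (c * a + d) (c * b + d) =
      (fun x : ℝ × ℝ => (c * x.1 + d, c * x.2 + d)) '' gaps q k h a b := by
    ext ⟨s, t⟩
    constructor
    · rintro ⟨h1, h2, h3, h4, h5⟩
      have hs : c * ((s - d) / c) + d = s := by field_simp; ring
      have ht : c * ((t - d) / c) + d = t := by field_simp; ring
      have e1 : a ≤ (s - d) / c := by rw [le_div_iff₀ hc]; dsimp at h1; linarith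
      have e2 : (s - d) / c < (t - d) / c := by dsimp at h2; gcongr
      have e3 : (t - d) / c ≤ b := by rw [div_le_iff₀ hc]; dsimp at h3; linarith
      refine ⟨((s - d) / c, (t - d) / c), ⟨e1, e2, e3, ?_, ?_⟩, Prod.ext hs ht⟩
      · dsimp only
        rw [hgh _ ⟨e1, e2.le.trans e3⟩, hgh _ ⟨e1.trans e2.le, e3⟩, hs, ht]
        exact h4
      · rintro u ⟨hu1, hu2⟩ j
        dsimp only at hu1 hu2
        rw [hgh u ⟨e1.trans hu1.le, hu2.le.trans e3⟩]
        refine h5 _ ⟨?_, ?_⟩ j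
        · rw [← hs]; dsimp only; gcongr
        · rw [← ht]; dsimp only; gcongr
    · rintro ⟨⟨s, t⟩, ⟨h1, h2, h3, h4, h5⟩, hx⟩
      obtain ⟨rfl, rfl⟩ := Prod.ext_iff.1 hx
      dsimp only at h1 h2 h3 h4 h5 ⊢
      refine ⟨by dsimp only; gcongr, by dsimp only; gcongr, by dsimp only; gcongr, ?_, ?_⟩
      · dsimp only
        rw [← hgh _ ⟨h1, h2.le.trans h3⟩, ← hgh _ ⟨h1.trans h2.le, h3⟩]
        exact h4
      · rintro u ⟨hu1, hu2⟩ j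
        dsimp only at hu1 hu2
        have hu : c * ((u - d) / c) + d = u := by field_simp; ring
        have e1 : s < (u - d) / c := by rw [lt_div_iff₀ hc]; linarith
        have e2 : (u - d) / c < t := by rw [div_lt_iff₀ hc]; linarith
        have := h5 _ ⟨e1, e2⟩ j
        rwa [hgh _ ⟨h1.trans e1.le, e2.le.trans h3⟩, hu] at this
  rw [this, Set.ncard_image_of_injective]
  rintro ⟨s, t⟩ ⟨s', t'⟩ hst
  obtain ⟨h1, h2⟩ := Prod.ext_iff.1 hst
  dsimp only at h1 h2
  exact Prod.ext (mul_left_cancel₀ hc.ne' (add_right_cancel h1))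
    (mul_left_cancel₀ hc.ne' (add_right_cancel h2))

theorem ncard_gaps_reverse (q : ℕ → M) (k : ℕ) {g h : ℝ → M}
    (hgh : ∀ t, h t = g (1 - t)) :
    (gaps q k h 0 1).ncard = (gaps q k g 0 1).ncard := by
  have key : ∀ {g h : ℝ → M}, (∀ t, h t = g (1 - t)) → ∀ {x : ℝ × ℝ}, x ∈ gaps q k h 0 1 →
      (1 - x.2, 1 - x.1) ∈ gaps q k g 0 1 := by
    rintro g h hgh ⟨s, t⟩ ⟨h1, h2, h3, h4, h5⟩
    dsimp only at *
    refine ⟨by dsimp; linarith, by dsimp; linarith, by dsimp; linarith, ?_, ?_⟩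
    · dsimp only
      rw [← hgh, ← hgh]
      tauto
    · rintro u ⟨hu1, hu2⟩ j
      have := h5 (1 - u) ⟨by dsimp at *; linarith, by dsimp at *; linarith⟩ j
      rwa [hgh, sub_sub_cancel] at this
  refine Set.ncard_congr (fun x _ => (1 - x.2, 1 - x.1)) (fun x hx => key hgh hx) ?_ ?_
  · rintro ⟨s, t⟩ ⟨s', t'⟩ - - hst
    obtain ⟨h1, h2⟩ := Prod.ext_iff.1 hst
    dsimp only at h1 h2
    exact Prod.ext (by dsimp; linarith) (by dsimp; linarith)
  · intro x hx
    exact ⟨(1 - x.2, 1 - x.1), key (fun t => by rw [hgh, sub_sub_cancel]) hx, by simp⟩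

/-- Only a gap straddling `m` can spoil additivity. All straddling gaps coincide, as they share `m`,
and the values at the ends of that one gap determine `k` up to finitely many choices. This is why
the invariant is defined only up to finitely many `k`. -/
theorem ncard_gaps_split [TopologicalSpace M] [T1Space M] {q : ℕ → M}
    (hq : Function.Injective q) {g : ℝ → M} (hg : Continuous g) {a m b : ℝ}
    (ham : a ≤ m) (hmb : m ≤ b) :
    ∀ᶠ k in atTop, (gaps q k g a b).ncard = (gaps q k g a m).ncard + (gaps q k g m b).ncard := by
  have hfin : ∀ᶠ k in atTop, ¬ ∃ x ∈ gaps q k g a b, x.1 < m ∧ m < x.2 := by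
    rw [← Nat.cofinite_eq_atTop, Filter.eventually_cofinite]
    by_cases hne : ∃ l, ∃ x ∈ gaps q l g a b, x.1 < m ∧ m < x.2
    · obtain ⟨l, y, hy, hy1, hy2⟩ := hne
      refine (Set.finite_Icc (l - 1) (l + 1)).subset fun k hk => ?_
      obtain ⟨x, hx, hx1, hx2⟩ := not_not.1 hk
      obtain rfl := gaps_eq_of_overlap hx hy (hx1.trans hy2) (hy1.trans hx2)
      have hkl : k = l ∨ k = l + 1 ∨ k + 1 = l ∨ k + 1 = l + 1 := by
        rcases hx.2.2.2.1 with h | h <;> rcases hy.2.2.2.1 with h' | h'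
        · exact Or.inl (hq (h.1.symm.trans h'.1))
        · exact Or.inr (Or.inl (hq (h.1.symm.trans h'.1)))
        · exact Or.inr (Or.inr (Or.inl (hq (h.1.symm.trans h'.1))))
        · exact Or.inr (Or.inr (Or.inr (hq (h.1.symm.trans h'.1))))
      rw [Set.mem_Icc]
      omega
    · refine Set.finite_empty.subset fun k hk => hne ?_
      exact ⟨k, not_not.1 hk⟩
  filter_upwards [hfin] with k hk
  rw [← Set.ncard_union_eq _ (gaps_finite hq k hg a m) (gaps_finite hq k hg m b)]
  · congr 1
    ext x
    constructor
    · intro hx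
      by_cases h : x.2 ≤ m
      · exact Or.inl ⟨hx.1, hx.2.1, h, hx.2.2.2⟩
      · refine Or.inr ⟨?_, hx.2.1, hx.2.2.1, hx.2.2.2⟩
        by_contra h'
        exact hk ⟨x, hx, not_le.1 h', not_le.1 h⟩
    · rintro (hx | hx)
      · exact ⟨hx.1, hx.2.1, hx.2.2.1.trans hmb, hx.2.2.2⟩
      · exact ⟨ham.trans hx.1, hx.2.1, hx.2.2.1, hx.2.2.2⟩
  · rw [Set.disjoint_left]
    intro x hx hx'
    have h1 := hx.2.1
    have h2 := hx.2.2.1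
    have h3 := hx'.1
    linarith

end Gaps

/-! ### Parity of the crossings of an interval by a real function -/

section Crossings

/-- The intervals `[c,d]` in `[0,x]` that `φ` maps across `[s,t]`, in either direction, with
interior going to interior. -/
def crossings (φ : ℝ → ℝ) (s t x : ℝ) : Set (ℝ × ℝ) :=
  {y | 0 ≤ y.1 ∧ y.1 < y.2 ∧ y.2 ≤ x ∧ (φ y.1 = s ∧ φ y.2 = t ∨ φ y.1 = t ∧ φ y.2 = s) ∧
    ∀ u ∈ Ioo y.1 y.2, φ u ∈ Ioo s t}

theorem crossings_mono {φ : ℝ → ℝ} {s t x y : ℝ} (hxy : x ≤ y) :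
    crossings φ s t x ⊆ crossings φ s t y :=
  fun _ hz => ⟨hz.1, hz.2.1, hz.2.2.1.trans hxy, hz.2.2.2⟩

/-- This symmetry lets the statement about a last upward crossing serve for downward ones too. -/
theorem neg_crossings (φ : ℝ → ℝ) (s t x : ℝ) :
    crossings (fun u => -φ u) (-t) (-s) x = crossings φ s t x := by
  ext y
  simp only [crossings, Set.mem_ofPred_eq, neg_inj, Set.mem_Ioo, neg_lt_neg_iff]
  have : (∀ u, y.1 < u ∧ u < y.2 → φ u < t ∧ s < φ u) ↔
      ∀ u, y.1 < u ∧ u < y.2 → s < φ u ∧ φ u < t := by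
    simp only [and_comm (a := φ _ < t)]
  rw [this, or_comm]

/-- Past the last time `a` at which `φ ≤ s`, exactly one further crossing happens before `φ`
exceeds `t`. -/
theorem exists_crossings_eq_insert {φ : ℝ → ℝ} (hφ : Continuous φ) {s t x z : ℝ} (hst : s < t)
    (hz : 0 ≤ z) (hzx : z ≤ x) (hzs : φ z ≤ s) (hx : t ≤ φ x) :
    ∃ a y, 0 ≤ a ∧ a ≤ x ∧ φ a ≤ s ∧ y ∉ crossings φ s t a ∧
      crossings φ s t x = insert y (crossings φ s t a) := by
  have hA : IsCompact (Icc 0 x ∩ φ ⁻¹' Iic s) :=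
    isCompact_Icc.inter_right (isClosed_Iic.preimage hφ)
  obtain ⟨a, ⟨⟨ha0, hax⟩, has⟩, hamax⟩ := hA.exists_isGreatest ⟨z, ⟨hz, hzx⟩, hzs⟩
  replace has : φ a ≤ s := has
  have hlast : ∀ u, a < u → u ≤ x → s < φ u := by
    intro u hu hux
    by_contra h
    exact absurd (hamax ⟨⟨ha0.trans hu.le, hux⟩, not_lt.1 h⟩) (not_le.2 hu)
  have hB : IsCompact (Icc a x ∩ φ ⁻¹' Ici t) :=
    isCompact_Icc.inter_right (isClosed_Ici.preimage hφ)
  obtain ⟨b, ⟨⟨hab, hbx⟩, hbt⟩, hbmin⟩ := hB.exists_isLeast ⟨x, ⟨hax, le_rfl⟩, hx⟩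
  replace hbt : t ≤ φ b := hbt
  have hfirst : ∀ u, a ≤ u → u < b → φ u < t := by
    intro u hu hub
    by_contra h
    exact absurd (hbmin ⟨⟨hu, hub.le.trans hbx⟩, not_lt.1 h⟩) (not_le.2 hub)
  have hab' : a < b := by
    rcases hab.lt_or_eq with h | h
    · exact h
    · subst h; linarith
  have hφa : φ a = s := by
    by_contra h
    obtain ⟨u, ⟨hu1, hu2⟩, hu⟩ := intermediate_value_Icc hab hφ.continuousOn
      (show s ∈ Icc (φ a) (φ b) from ⟨has, hst.le.trans hbt⟩)
    have : a < u := lt_of_le_of_ne hu1 (by rintro rfl; exact h hu)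
    exact absurd (hlast u this (hu2.trans hbx)) (by rw [hu]; exact lt_irrefl s)
  have hφb : φ b = t := by
    by_contra h
    obtain ⟨u, ⟨hu1, hu2⟩, hu⟩ := intermediate_value_Icc hab hφ.continuousOn
      (show t ∈ Icc (φ a) (φ b) from ⟨has.trans hst.le, hbt⟩)
    have : u < b := lt_of_le_of_ne hu2 (by rintro rfl; exact h hu)
    exact absurd (hfirst u hu1 this) (by rw [hu]; exact lt_irrefl t)
  refine ⟨a, (a, b), ha0, hax, has, fun h => not_lt.2 h.2.2.1 hab', ?_⟩
  ext ⟨c, d⟩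
  constructor
  · rintro ⟨h1, h2, h3, h4, h5⟩
    dsimp only at h1 h2 h3 h4 h5
    by_cases hd : d ≤ a
    · exact Or.inr ⟨h1, h2, hd, h4, h5⟩
    left
    rw [not_le] at hd
    have hca : ¬ c < a := fun h => by
      have := (h5 a ⟨h, hd⟩).1
      linarith
    have hds : s < φ d := hlast d hd h3
    have hc : φ c = s ∧ φ d = t := by
      rcases h4 with h | h
      · exact h
      · linarith [h.2]
    obtain rfl : c = a := by
      by_contra hne
      have := hlast c (lt_of_le_of_ne (not_lt.1 hca) (Ne.symm hne)) (h2.le.trans h3)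
      linarith [hc.1]
    have hbd : b ≤ d := hbmin ⟨⟨hd.le, h3⟩, hc.2.ge⟩
    rcases hbd.lt_or_eq with h | rfl
    · linarith [(h5 b ⟨hab', h⟩).2]
    · rfl
  · rintro (h | h)
    · obtain ⟨rfl, rfl⟩ := Prod.ext_iff.1 h
      exact ⟨ha0, hab', hbx, Or.inl ⟨hφa, hφb⟩,
        fun u hu => ⟨hlast u hu.1 (hu.2.le.trans hbx), hfirst u hu.1.le hu.2⟩⟩
    · exact crossings_mono hax h

/-- Cutting off the last crossing leaves a time at which `φ` is on the other side of `(s,t)`, with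
one crossing fewer; the parity therefore records the side. -/
theorem even_odd_ncard_crossings {φ : ℝ → ℝ} (hφ : Continuous φ) {s t : ℝ} (hst : s < t)
    (h0 : φ 0 ≤ s) (hfin : (crossings φ s t 1).Finite) (n : ℕ) :
    ∀ x, 0 ≤ x → x ≤ 1 → (crossings φ s t x).ncard = n →
      (φ x ≤ s → Even n) ∧ (t ≤ φ x → Odd n) := by
  induction n using Nat.strong_induction_on with
  | _ n ih =>
    intro x hx0 hx1 hn
    constructor
    · intro hxs
      by_cases hz : ∃ z, 0 ≤ z ∧ z ≤ x ∧ t ≤ φ z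
      · obtain ⟨z, hz0, hzx, hzt⟩ := hz
        obtain ⟨a, y, ha0, hax, hat, hya, hins⟩ := exists_crossings_eq_insert (φ := fun u => -φ u) hφ.neg
          (neg_lt_neg hst) hz0 hzx (neg_le_neg hzt) (neg_le_neg hxs)
        simp only [neg_crossings] at hya hins
        have hcard : (crossings φ s t a).ncard + 1 = n := by
          rw [← hn, hins, Set.ncard_insert_of_notMem hya
            (hfin.subset (crossings_mono (hax.trans hx1)))]
        have := (ih _ (by omega) a ha0 (hax.trans hx1) rfl).2 (neg_le_neg_iff.1 hat)
        rw [← hcard]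
        exact this.add_one
      · have : crossings φ s t x = ∅ := by
          rw [Set.eq_empty_iff_forall_notMem]
          rintro y ⟨h1, h2, h3, h4, -⟩
          rcases h4 with h | h
          · exact hz ⟨y.2, h1.trans h2.le, h3, h.2.ge⟩
          · exact hz ⟨y.1, h1, h2.le.trans h3, h.1.ge⟩
        rw [this, Set.ncard_empty] at hn
        rw [← hn]
        exact Even.zero
    · intro hxt
      obtain ⟨a, y, ha0, hax, has, hya, hins⟩ := exists_crossings_eq_insert hφ hst le_rfl hx0 h0 hxt
      have hcard : (crossings φ s t a).ncard + 1 = n := by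
        rw [← hn, hins, Set.ncard_insert_of_notMem hya
          (hfin.subset (crossings_mono (hax.trans hx1)))]
      have := (ih _ (by omega) a ha0 (hax.trans hx1) rfl).1 has
      rw [← hcard]
      exact this.add_one

theorem odd_ncard_crossings {φ : ℝ → ℝ} (hφ : Continuous φ) {s t : ℝ} (hst : s < t)
    (h0 : φ 0 ≤ s) (h1 : t ≤ φ 1) (hfin : (crossings φ s t 1).Finite) :
    Odd (crossings φ s t 1).ncard :=
  (even_odd_ncard_crossings hφ hst h0 hfin _ 1 zero_le_one le_rfl rfl).2 h1

end Crossings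

/-! ### Gaps under reparametrization -/

section Reparametrization

variable {M : Type*}

/-- By the intermediate value theorem every time strictly between the images of the end points is
attained inside the gap, so a visit of `g` there would be a visit of `g ∘ φ`. -/
theorem gaps_comp_mem {q : ℕ → M} (hq : Function.Injective q) {k : ℕ} {g : ℝ → M} {φ : ℝ → ℝ}
    (hφ : Continuous φ) (hI : ∀ u, φ u ∈ Icc (0 : ℝ) 1) {y : ℝ × ℝ}
    (hy : y ∈ gaps q k (g ∘ φ) 0 1) :
    (min (φ y.1) (φ y.2), max (φ y.1) (φ y.2)) ∈ gaps q k g 0 1 := by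
  obtain ⟨c, d⟩ := y
  obtain ⟨h1, h2, h3, h4, h5⟩ := hy
  dsimp only [Function.comp] at h1 h2 h3 h4 h5 ⊢
  have hne : φ c ≠ φ d := by
    intro h
    rw [h] at h4
    have : q k = q (k + 1) := by rcases h4 with h | h <;> rw [← h.1, ← h.2]
    have := hq this
    omega
  refine ⟨le_min (hI c).1 (hI d).1, min_lt_max.2 hne, max_le (hI c).2 (hI d).2, ?_, ?_⟩
  · rcases hne.lt_or_gt with h | h
    · simpa [min_eq_left h.le, max_eq_right h.le] using h4
    · simpa [min_eq_right h.le, max_eq_left h.le, or_comm, and_comm] using h4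
  · rintro w ⟨hw1, hw2⟩ j
    dsimp only at hw1 hw2
    have : w ∈ φ '' Ioo c d := by
      rcases hne.lt_or_gt with h | h
      · rw [min_eq_left h.le] at hw1
        rw [max_eq_right h.le] at hw2
        exact intermediate_value_Ioo h2.le hφ.continuousOn ⟨hw1, hw2⟩
      · rw [min_eq_right h.le] at hw1
        rw [max_eq_left h.le] at hw2
        exact intermediate_value_Ioo' h2.le hφ.continuousOn ⟨hw1, hw2⟩
    obtain ⟨u, hu, rfl⟩ := this
    exact h5 u hu j

/-- If `φ` left `(s,t)` inside such a gap, it would have to pass through `s` or `t` there, where `g`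
takes one of the values `q j`. -/
theorem gaps_comp_fiber {q : ℕ → M} {k : ℕ} {g : ℝ → M} {φ : ℝ → ℝ}
    (hφ : Continuous φ) {x : ℝ × ℝ} (hx : x ∈ gaps q k g 0 1) :
    {y | y ∈ gaps q k (g ∘ φ) 0 1 ∧ (min (φ y.1) (φ y.2), max (φ y.1) (φ y.2)) = x} =
      crossings φ x.1 x.2 1 := by
  obtain ⟨s, t⟩ := x
  have hs := gaps_left_visit hx
  have ht := gaps_right_visit hx
  obtain ⟨-, hst, -, hx4, hx5⟩ := hx
  dsimp only at hs ht hst hx4 hx5 ⊢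
  ext ⟨c, d⟩
  constructor
  · rintro ⟨⟨h1, h2, h3, h4, h5⟩, hcd⟩
    dsimp only [Function.comp] at h1 h2 h3 h4 h5
    obtain ⟨e1, e2⟩ := Prod.ext_iff.1 hcd
    dsimp only at e1 e2
    have hends : φ c = s ∧ φ d = t ∨ φ c = t ∧ φ d = s := by
      rcases le_total (φ c) (φ d) with h | h
      · rw [min_eq_left h] at e1; rw [max_eq_right h] at e2; exact Or.inl ⟨e1, e2⟩
      · rw [min_eq_right h] at e1; rw [max_eq_left h] at e2; exact Or.inr ⟨e2, e1⟩
    have hnot : ∀ w ∈ Ioo c d, φ w ≠ s ∧ φ w ≠ t := by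
      intro w hw
      constructor
      · rintro h; obtain ⟨j, hj⟩ := hs; exact h5 w hw j (by rw [h, hj])
      · rintro h; obtain ⟨j, hj⟩ := ht; exact h5 w hw j (by rw [h, hj])
    refine ⟨h1, h2, h3, hends, fun u hu => ?_⟩
    constructor
    · by_contra hlt
      have hlt' : φ u < s := lt_of_le_of_ne (not_lt.1 hlt) (hnot u hu).1
      rcases hends with h | h
      · obtain ⟨w, hw, hws⟩ := intermediate_value_Ioo hu.2.le hφ.continuousOn
          (show s ∈ Ioo (φ u) (φ d) from ⟨hlt', by rw [h.2]; exact hst⟩)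
        exact (hnot w ⟨hu.1.trans hw.1, hw.2⟩).1 hws
      · obtain ⟨w, hw, hws⟩ := intermediate_value_Ioo' hu.1.le hφ.continuousOn
          (show s ∈ Ioo (φ u) (φ c) from ⟨hlt', by rw [h.1]; exact hst⟩)
        exact (hnot w ⟨hw.1, hw.2.trans hu.2⟩).1 hws
    · by_contra hlt
      have hlt' : t < φ u := lt_of_le_of_ne (not_lt.1 hlt) (hnot u hu).2.symm
      rcases hends with h | h
      · obtain ⟨w, hw, hws⟩ := intermediate_value_Ioo hu.1.le hφ.continuousOn
          (show t ∈ Ioo (φ c) (φ u) from ⟨by rw [h.1]; exact hst, hlt'⟩)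
        exact (hnot w ⟨hw.1, hw.2.trans hu.2⟩).2 hws
      · obtain ⟨w, hw, hws⟩ := intermediate_value_Ioo' hu.2.le hφ.continuousOn
          (show t ∈ Ioo (φ d) (φ u) from ⟨by rw [h.2]; exact hst, hlt'⟩)
        exact (hnot w ⟨hu.1.trans hw.1, hw.2⟩).2 hws
  · rintro ⟨h1, h2, h3, h4, h5⟩
    dsimp only at h1 h2 h3 h4 h5
    refine ⟨⟨h1, h2, h3, ?_, fun u hu j => hx5 _ (h5 u hu) j⟩, ?_⟩
    · dsimp only [Function.comp]
      rcases h4 with h | h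
      · rw [h.1, h.2]; exact hx4
      · rw [h.1, h.2]; tauto
    · dsimp only
      rcases h4 with h | h
      · rw [h.1, h.2, min_eq_left hst.le, max_eq_right hst.le]
      · rw [h.1, h.2, min_eq_right hst.le, max_eq_left hst.le]

/-- Since `φ` may backtrack, the number of gaps itself can grow; but each gap of `g` is replaced by
its crossings, an odd number because `φ` runs from 0 to 1. -/
theorem ncard_gaps_comp [TopologicalSpace M] [T1Space M] {q : ℕ → M} (hq : Function.Injective q)
    (k : ℕ) {g : ℝ → M} (hg : Continuous g) {φ : ℝ → ℝ} (hφ : Continuous φ)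
    (hI : ∀ u, φ u ∈ Icc (0 : ℝ) 1) (h0 : φ 0 = 0) (h1 : φ 1 = 1) :
    ((gaps q k (g ∘ φ) 0 1).ncard : ZMod 2) = (gaps q k g 0 1).ncard := by
  classical
  have hA := gaps_finite hq k (hg.comp hφ) 0 1
  have hB := gaps_finite hq k hg 0 1
  rw [Set.ncard_eq_toFinset_card _ hA, Set.ncard_eq_toFinset_card _ hB,
    Finset.card_eq_sum_card_fiberwise (s := hA.toFinset) (t := hB.toFinset)
      (f := fun y => (min (φ y.1) (φ y.2), max (φ y.1) (φ y.2)))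
      (fun y hy => by
        have hy' : y ∈ gaps q k (g ∘ φ) 0 1 := by simpa using hy
        simpa using gaps_comp_mem hq hφ hI hy'),
    Finset.card_eq_sum_ones, Nat.cast_sum, Nat.cast_sum]
  refine Finset.sum_congr rfl fun x hx => ?_
  have hx' : x ∈ gaps q k g 0 1 := by simpa using hx
  have hfib := gaps_comp_fiber (q := q) (k := k) (g := g) hφ hx'
  have hfin : (crossings φ x.1 x.2 1).Finite := by
    rw [← hfib]
    exact hA.subset fun y hy => hy.1
  have hodd := odd_ncard_crossings hφ hx'.2.1 (by rw [h0]; exact hx'.1)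
    (by rw [h1]; exact hx'.2.2.1) hfin
  rw [← hfib] at hodd
  have hcard : (hA.toFinset.filter fun y => (min (φ y.1) (φ y.2), max (φ y.1) (φ y.2)) = x).card =
      {y | y ∈ gaps q k (g ∘ φ) 0 1 ∧ (min (φ y.1) (φ y.2), max (φ y.1) (φ y.2)) = x}.ncard := by
    rw [← Set.ncard_coe_finset]
    congr 1
    ext y
    simp
  rw [hcard, Nat.cast_one]
  exact (ZMod.natCast_eq_one_iff_odd).2 hodd

end Reparametrization

/-! ### The retrace invariant -/

section GapParity

variable {M : Type*} [TopologicalSpace M]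

/-- The parity of the number of gaps of `γ` between `q k` and `q (k+1)`. -/
noncomputable def gapParity (q : ℕ → M) {x y : M} (γ : Path x y) (k : ℕ) : ZMod 2 :=
  ((gaps q k γ.extend 0 1).ncard : ZMod 2)

variable {q : ℕ → M} {x y z : M}

theorem gapParity_symm (γ : Path x y) : gapParity q γ.symm = gapParity q γ := by
  ext k
  rw [gapParity, gapParity, ncard_gaps_reverse q k γ.extend_symm_apply]

theorem gapParity_refl (hx : ∀ k, q k ≠ x) : gapParity q (Path.refl x) = 0 := by
  ext k
  have : gaps q k (Path.refl x).extend 0 1 = ∅ := by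
    rw [Set.eq_empty_iff_forall_notMem]
    intro u hu
    obtain ⟨j, hj⟩ := gaps_left_visit hu
    exact hx j (by simpa using hj.symm)
  rw [gapParity, this, Set.ncard_empty, Nat.cast_zero, Pi.zero_apply]

theorem gapParity_of_visits (γ : Path x y) {c : ℕ → ℝ} (hc : StrictMono c)
    (hcI : ∀ j, c j ∈ Icc (0 : ℝ) 1)
    (h : ∀ t ∈ Icc (0 : ℝ) 1, ∀ j, γ.extend t = q j ↔ t = c j) (k : ℕ) : gapParity q γ k = 1 := by
  have hlt : c k < c (k + 1) := hc k.lt_succ_self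
  have : gaps q k γ.extend 0 1 = {(c k, c (k + 1))} := by
    ext ⟨s, t⟩
    rw [Set.mem_singleton_iff]
    constructor
    · rintro ⟨h1, h2, h3, h4, -⟩
      dsimp only at h1 h2 h3 h4
      rw [h s ⟨h1, h2.le.trans h3⟩, h s ⟨h1, h2.le.trans h3⟩, h t ⟨h1.trans h2.le, h3⟩,
        h t ⟨h1.trans h2.le, h3⟩] at h4
      rcases h4 with h4 | h4
      · exact Prod.ext h4.1 h4.2
      · rw [h4.1, h4.2] at h2
        exact absurd hlt (not_lt.2 h2.le)
    · intro hst
      obtain ⟨rfl, rfl⟩ := Prod.ext_iff.1 hst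
      refine ⟨(hcI _).1, hlt, (hcI _).2, Or.inl ⟨(h _ (hcI _) _).2 rfl, (h _ (hcI _) _).2 rfl⟩, ?_⟩
      rintro u ⟨hu1, hu2⟩ j hj
      dsimp only at hu1 hu2
      rw [h u ⟨(hcI _).1.trans hu1.le, hu2.le.trans (hcI _).2⟩] at hj
      subst hj
      rw [hc.lt_iff_lt] at hu1 hu2
      omega
  rw [gapParity, this, Set.ncard_singleton, Nat.cast_one]

variable [T1Space M]

theorem gapParity_trans (hq : Function.Injective q) (γ : Path x y) (δ : Path y z) :
    gapParity q (γ.trans δ) =ᶠ[atTop] gapParity q γ + gapParity q δ := by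
  filter_upwards [ncard_gaps_split hq (γ.trans δ).continuous_extend
    (show (0 : ℝ) ≤ 1 / 2 by norm_num) (show (1 / 2 : ℝ) ≤ 1 by norm_num)] with k hk
  have h1 : (gaps q k (γ.trans δ).extend 0 (1 / 2)).ncard = (gaps q k γ.extend 0 1).ncard := by
    rw [ncard_gaps_affine q k (g := γ.extend) (c := 2) (d := 0) two_pos]
    · norm_num
    · intro t ht
      rw [Path.extend_trans_of_le_half _ _ ht.2, add_zero]
  have h2 : (gaps q k (γ.trans δ).extend (1 / 2) 1).ncard = (gaps q k δ.extend 0 1).ncard := by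
    rw [ncard_gaps_affine q k (g := δ.extend) (c := 2) (d := -1) two_pos]
    · norm_num
    · intro t ht
      rw [Path.extend_trans_of_half_le _ _ ht.1, ← sub_eq_add_neg]
  rw [Pi.add_apply, gapParity, gapParity, gapParity, hk, h1, h2, Nat.cast_add]

/-- Both halves have the same count, so the sum vanishes in `ZMod 2`; this cancellation is the
reason for working modulo 2. -/
theorem gapParity_trans_symm (hq : Function.Injective q) (β : Path x y) :
    gapParity q (β.trans β.symm) =ᶠ[atTop] 0 := by
  filter_upwards [gapParity_trans hq β β.symm] with k hk
  rw [hk, gapParity_symm, Pi.add_apply, CharTwo.add_self_eq_zero, Pi.zero_apply]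

variable {E H : Type*} [NormedAddCommGroup E] [NormedSpace ℝ E] [TopologicalSpace H]
  [ChartedSpace H M] {J : ModelWithCorners ℝ E H} {p : M}

theorem IsRetracing.gapParity_eventuallyEq (hq : Function.Injective q) {γ γ' : Path p p}
    (h : IsRetracing J γ γ') : gapParity q γ =ᶠ[atTop] gapParity q γ' := by
  rcases h with ⟨α₁, β, α₂, -, -, -⟩ | ⟨β, α, -, -⟩ | ⟨α, β, -, -⟩
  · filter_upwards [gapParity_trans hq (α₁.trans (β.trans β.symm)) α₂,
      gapParity_trans hq α₁ (β.trans β.symm), gapParity_trans_symm hq β,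
      gapParity_trans hq α₁ α₂] with k h1 h2 h3 h4
    simp only [Pi.add_apply] at h1 h2 h4
    rw [h1, h2, h3, h4, Pi.zero_apply, add_zero]
  · filter_upwards [gapParity_trans hq (β.trans β.symm) γ', gapParity_trans_symm hq β]
      with k h1 h2
    rw [h1, Pi.add_apply, h2, Pi.zero_apply, zero_add]
  · filter_upwards [gapParity_trans hq γ' (β.trans β.symm), gapParity_trans_symm hq β]
      with k h1 h2
    rw [h1, Pi.add_apply, h2, Pi.zero_apply, add_zero]

theorem gapParity_reparam (hq : Function.Injective q) {γ γ' : Path p p} {φ : I → I}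
    (hφ : IsGenReparam φ) (h : ∀ t, γ' t = γ (φ t)) : gapParity q γ' = gapParity q γ := by
  ext k
  have key := ncard_gaps_comp hq k γ.continuous_extend
    (φ := fun s : ℝ => (φ (Set.projIcc 0 1 zero_le_one s) : ℝ))
    (continuous_subtype_val.comp (hφ.continuous.comp continuous_projIcc)) (fun u => (φ _).2)
    (by simp [hφ.map_zero]) (by simp [hφ.map_one])
  have hcomp : γ.extend ∘ (fun s : ℝ => (φ (Set.projIcc 0 1 zero_le_one s) : ℝ)) = γ'.extend := by
    ext s
    rw [Function.comp_apply, Path.extend_extends', ← h]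
    rfl
  rwa [hcomp] at key

theorem RetStep.gapParity_eventuallyEq (hq : Function.Injective q) {γ γ' : PSLoop J p}
    (h : RetStep J γ γ') : gapParity q γ.1 =ᶠ[atTop] gapParity q γ'.1 := by
  rcases h with ⟨φ, hφ, h⟩ | h
  · rw [gapParity_reparam hq hφ h]
  · exact h.gapParity_eventuallyEq hq

/-- Up to finitely many `k`, the gap parities are invariants of retrace equivalence. -/
theorem gapParity_eventuallyEq_of_retSetoid (hq : Function.Injective q) {γ γ' : PSLoop J p}
    (h : retSetoid J p γ γ') : gapParity q γ.1 =ᶠ[atTop] gapParity q γ'.1 := by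
  replace h : Relation.EqvGen (RetStep J) γ γ' := h
  induction h with
  | rel _ _ h => exact RetStep.gapParity_eventuallyEq hq h
  | refl _ => exact EventuallyEq.rfl
  | symm _ _ _ ih => exact ih.symm
  | trans _ _ _ _ _ ih₁ ih₂ => exact ih₁.trans ih₂

end GapParity

/-! ### A smooth bump with a unique maximum -/

section Pulse

/-- A smooth function on `ℝ`, symmetric about `1/2`, that is positive exactly on `(0,1)` and
attains its maximum `1` exactly at `1/2`. -/
noncomputable def pulse (u : ℝ) : ℝ :=
  Real.exp 4 * (expNegInvGlue u * expNegInvGlue (1 - u))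

theorem contDiff_pulse : ContDiff ℝ ∞ pulse :=
  contDiff_const.mul (expNegInvGlue.contDiff.mul
    (expNegInvGlue.contDiff.comp (contDiff_const.sub contDiff_id)))

theorem pulse_one_sub (u : ℝ) : pulse (1 - u) = pulse u := by
  rw [pulse, pulse, sub_sub_cancel, mul_comm (expNegInvGlue u)]

theorem pulse_of_nonpos {u : ℝ} (hu : u ≤ 0) : pulse u = 0 := by
  rw [pulse, expNegInvGlue.zero_of_nonpos hu, zero_mul, mul_zero]

theorem pulse_of_one_le {u : ℝ} (hu : 1 ≤ u) : pulse u = 0 := by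
  rw [← pulse_one_sub, pulse_of_nonpos (by linarith)]

theorem mem_Ioo_of_pulse_ne_zero {u : ℝ} (hu : pulse u ≠ 0) : u ∈ Ioo (0 : ℝ) 1 :=
  ⟨not_le.1 fun h => hu (pulse_of_nonpos h), not_le.1 fun h => hu (pulse_of_one_le h)⟩

theorem pulse_nonneg (u : ℝ) : 0 ≤ pulse u :=
  mul_nonneg (Real.exp_pos 4).le (mul_nonneg (expNegInvGlue.nonneg _) (expNegInvGlue.nonneg _))

/-- The exponent `4 - 1/u - 1/(1-u)` is minus a square over a positive quantity, which makes the
maximum visible. -/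
theorem pulse_of_mem {u : ℝ} (hu : u ∈ Ioo (0 : ℝ) 1) :
    pulse u = Real.exp (-((2 * u - 1) ^ 2 / (u * (1 - u)))) := by
  have h1 : 0 < u := hu.1
  have h2 : 0 < 1 - u := by linarith [hu.2]
  rw [pulse, expNegInvGlue, expNegInvGlue, if_neg (not_le.2 h1), if_neg (not_le.2 h2),
    ← Real.exp_add, ← Real.exp_add]
  congr 1
  field_simp
  ring

theorem pulse_le_one (u : ℝ) : pulse u ≤ 1 := by
  by_cases h : pulse u = 0
  · rw [h]; exact zero_le_one
  · have hu := mem_Ioo_of_pulse_ne_zero h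
    have h2 : 0 < 1 - u := by linarith [hu.2]
    have h1 : 0 < u := hu.1
    rw [pulse_of_mem hu, Real.exp_le_one_iff, neg_nonpos]
    positivity

theorem pulse_eq_one_iff {u : ℝ} : pulse u = 1 ↔ u = 1 / 2 := by
  constructor
  · intro h
    have hu := mem_Ioo_of_pulse_ne_zero (by rw [h]; exact one_ne_zero)
    have h2 : 0 < 1 - u := by linarith [hu.2]
    have h1 : 0 < u := hu.1
    rw [pulse_of_mem hu, Real.exp_eq_one_iff, neg_eq_zero, div_eq_zero_iff] at h
    rcases h with h | h
    · have := pow_eq_zero_iff (two_ne_zero) |>.1 h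
      linarith
    · exact absurd h (mul_pos h1 h2).ne'
  · rintro rfl
    rw [pulse_of_mem ⟨by norm_num, by norm_num⟩]
    norm_num

theorem exists_bound_iteratedDeriv_pulse (m : ℕ) :
    ∃ C : ℝ, 0 ≤ C ∧ ∀ u, ‖iteratedDeriv m pulse u‖ ≤ C := by
  have hc : HasCompactSupport pulse := HasCompactSupport.intro (isCompact_Icc (a := (0 : ℝ)) (b := 1))
    fun u hu => by
      by_contra h
      exact hu (Ioo_subset_Icc_self (mem_Ioo_of_pulse_ne_zero h))
  have hcont : Continuous (iteratedFDeriv ℝ m pulse) :=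
    contDiff_pulse.continuous_iteratedFDeriv (by exact_mod_cast le_top)
  obtain ⟨C, hC⟩ := (hc.iteratedFDeriv m).exists_bound_of_continuous hcont
  exact ⟨C, (norm_nonneg _).trans (hC 0), fun u => by
    rw [← norm_iteratedFDeriv_eq_norm_iteratedDeriv]; exact hC u⟩

end Pulse

/-! ### Infinitely many shrinking excursions as one smooth curve -/

section PulseSum

variable {E : Type*} [NormedAddCommGroup E] [NormedSpace ℝ E]

/-- The time in the `k`-th interval `[1 - 2⁻ᵏ, 1 - 2⁻ᵏ⁻¹]`, rescaled to `[0,1]`. -/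
noncomputable def pulseTime (k : ℕ) (t : ℝ) : ℝ := 2 ^ (k + 1) * (t - 1) + 2

/-- The curve that goes out to `v 0` and back on `[0,1/2]`, then out to `v 1` and back on
`[1/2,3/4]`, and so on. -/
noncomputable def pulseSum (v : ℕ → E) (t : ℝ) : E := ∑' k, pulse (pulseTime k t) • v k

theorem pulseTime_eq_half_iff {k : ℕ} {t : ℝ} :
    pulseTime k t = 1 / 2 ↔ t = 1 - 3 / 4 * (1 / 2) ^ k := by
  have h : (2 : ℝ) ^ k * (1 / 2) ^ k = 1 := by rw [← mul_pow]; norm_num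
  have h' : (2 : ℝ) ^ k ≠ 0 := by positivity
  rw [pulseTime, pow_succ]
  constructor
  · intro ht
    apply mul_left_cancel₀ h'
    linear_combination ht / 2 + 3 / 4 * h
  · rintro rfl
    linear_combination -(3 / 2) * h

theorem pulse_pulseTime_disjoint {k j : ℕ} (hkj : k ≠ j) {t : ℝ}
    (hk : pulse (pulseTime k t) ≠ 0) : pulse (pulseTime j t) = 0 := by
  have key : ∀ {k j : ℕ}, k < j → pulse (pulseTime k t) ≠ 0 → pulse (pulseTime j t) ≠ 0 → False := by
    intro k j hkj hk hj
    have h1 := (mem_Ioo_of_pulse_ne_zero hk).2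
    have h2 := (mem_Ioo_of_pulse_ne_zero hj).1
    rw [pulseTime] at h1 h2
    have hp : (2 : ℝ) * 2 ^ (k + 1) ≤ 2 ^ (j + 1) := by
      rw [← pow_succ']
      exact pow_le_pow_right₀ one_le_two (by omega)
    have hp0 : (0 : ℝ) < 2 ^ (k + 1) := by positivity
    have ht : t - 1 < 0 := by
      by_contra h
      have := mul_nonneg hp0.le (not_lt.1 h)
      linarith
    have := mul_le_mul_of_nonpos_right hp ht.le
    linarith
  by_contra hj
  rcases hkj.lt_or_gt with h | h
  · exact key h hk hj
  · exact key h hj hk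

theorem pulseSum_eq_of_ne_zero (v : ℕ → E) {k : ℕ} {t : ℝ} (hk : pulse (pulseTime k t) ≠ 0) :
    pulseSum v t = pulse (pulseTime k t) • v k :=
  tsum_eq_single k fun j hj => by rw [pulse_pulseTime_disjoint hj.symm hk, zero_smul]

/-- At most one pulse is active at time `t`, and which one does not depend on `v`. If none is
active, the index 0 is arbitrary, since its coefficient vanishes. -/
theorem exists_forall_pulseSum_eq (t : ℝ) :
    ∃ k, ∀ v : ℕ → E, pulseSum v t = pulse (pulseTime k t) • v k := by
  by_cases h : ∃ k, pulse (pulseTime k t) ≠ 0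
  · obtain ⟨k, hk⟩ := h
    exact ⟨k, fun v => pulseSum_eq_of_ne_zero v hk⟩
  · push Not at h
    exact ⟨0, fun v => by simp [pulseSum, h]⟩

theorem norm_pulseSum_le {v : ℕ → E} {C : ℝ} (hv : ∀ k, ‖v k‖ ≤ C) (t : ℝ) :
    ‖pulseSum v t‖ ≤ C := by
  obtain ⟨k, hk⟩ := exists_forall_pulseSum_eq (E := E) t
  rw [hk, norm_smul, Real.norm_of_nonneg (pulse_nonneg _)]
  exact (mul_le_of_le_one_left (norm_nonneg _) (pulse_le_one _)).trans (hv k)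

theorem pulseSum_zero (v : ℕ → E) : pulseSum v 0 = 0 := by
  have : ∀ k, pulse (pulseTime k 0) = 0 := fun k => pulse_of_nonpos (by
    have : (1 : ℝ) ≤ 2 ^ k := one_le_pow₀ one_le_two
    rw [pulseTime, pow_succ]
    linarith)
  simp [pulseSum, this]

theorem pulseSum_one (v : ℕ → E) : pulseSum v 1 = 0 := by
  have : ∀ k, pulse (pulseTime k 1) = 0 := fun k => pulse_of_one_le (by
    rw [pulseTime]; norm_num)
  simp [pulseSum, this]

theorem pulseSum_of_le_half (v : ℕ → E) {t : ℝ} (ht : t ≤ 1 / 2) :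
    pulseSum v t = pulse (2 * t) • v 0 := by
  rw [pulseSum, tsum_eq_single 0, pulseTime]
  · congr 2; ring
  · intro k hk
    obtain ⟨k, rfl⟩ := Nat.exists_eq_succ_of_ne_zero hk
    have h1 : (1 : ℝ) ≤ 2 ^ k := one_le_pow₀ one_le_two
    rw [pulse_of_nonpos, zero_smul]
    rw [pulseTime, Nat.succ_eq_add_one, pow_succ, pow_succ]
    nlinarith

/-- Self-similarity: the second half is the curve of the shifted sequence at double speed, as in a
concatenation by `Path.trans`. -/
theorem pulseSum_of_half_le (v : ℕ → E) {t : ℝ} (ht : 1 / 2 ≤ t) :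
    pulseSum v t = pulseSum (fun k => v (k + 1)) (2 * t - 1) := by
  have hT : ∀ k, pulseTime (k + 1) t = pulseTime k (2 * t - 1) := fun k => by
    rw [pulseTime, pulseTime, pow_succ]; ring
  have h0 : pulse (pulseTime 0 t) = 0 := pulse_of_one_le (by
    rw [pulseTime, zero_add, pow_one]; linarith)
  by_cases h : ∃ j, pulse (pulseTime (j + 1) t) ≠ 0
  · obtain ⟨j, hj⟩ := h
    rw [pulseSum, pulseSum, tsum_eq_single (j + 1), tsum_eq_single j, hT]
    · intro i hi
      rw [← hT, pulse_pulseTime_disjoint (by omega) hj, zero_smul]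
    · intro i hi
      rw [pulse_pulseTime_disjoint (by omega) hj, zero_smul]
  · push Not at h
    have h' : ∀ i, pulse (pulseTime i t) = 0 := fun i => by
      cases i with
      | zero => exact h0
      | succ i => exact h i
    simp only [pulseSum, h', ← hT, zero_smul]

/-- Rescaling time costs a factor `(2 ^ (k + 1)) ^ m` in the `m`-th derivative of the `k`-th term.
For fixed `m` this is geometric in `k`, so the factorial keeps the series of derivatives summable
uniformly in `t`. -/
theorem contDiff_pulseSum [CompleteSpace E] {v : ℕ → E} {C : ℝ} (hv : ∀ k, ‖v k‖ ≤ C / k.factorial) :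
    ContDiff ℝ ∞ (pulseSum v) := by
  have hT : ∀ k, ContDiff ℝ ∞ fun t => pulse (pulseTime k t) := fun k =>
    contDiff_pulse.comp (by unfold pulseTime; fun_prop)
  choose B hB0 hB using exists_bound_iteratedDeriv_pulse
  refine contDiff_tsum (N := ⊤) (v := fun m k => B m * C * 2 ^ m * ((2 ^ m) ^ k / k.factorial))
    (fun k => (hT k).smul contDiff_const) (fun m _ => ?_) (fun m k t _ => ?_)
  · exact (Real.summable_pow_div_factorial _).mul_left _
  · rw [norm_iteratedFDeriv_eq_norm_iteratedDeriv]
    have h1 : iteratedDeriv m (fun t => pulse (pulseTime k t) • v k) t =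
        iteratedDeriv m (fun t => pulse (pulseTime k t)) t • v k :=
      iteratedDeriv_smul_const ((hT k).contDiffAt.of_le (by exact_mod_cast le_top)) _
    have h2 : iteratedDeriv m (fun t => pulse (pulseTime k t)) t =
        (2 ^ (k + 1)) ^ m * iteratedDeriv m pulse (pulseTime k t) := by
      have hsm : ContDiff ℝ m fun u => pulse (u + (2 - 2 ^ (k + 1))) :=
        (contDiff_pulse.comp (contDiff_id.add contDiff_const)).of_le (by exact_mod_cast le_top)
      have e : (fun t => pulse (pulseTime k t)) =
          fun t => (fun u => pulse (u + (2 - 2 ^ (k + 1)))) (2 ^ (k + 1) * t) := by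
        ext t; rw [pulseTime]; ring_nf
      rw [e, iteratedDeriv_comp_const_mul hsm, iteratedDeriv_comp_add_const, pulseTime]
      ring_nf
    rw [h1, h2, norm_smul, norm_mul, Real.norm_of_nonneg (by positivity)]
    calc (2 ^ (k + 1)) ^ m * ‖iteratedDeriv m pulse (pulseTime k t)‖ * ‖v k‖
        ≤ (2 ^ (k + 1)) ^ m * B m * (C / k.factorial) := by
          gcongr
          · exact mul_nonneg (by positivity) (hB0 m)
          · exact hB m _
          · exact hv k
      _ = _ := by
          rw [← pow_mul, ← pow_mul, show (k + 1) * m = m + m * k by ring, pow_add]; ring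

end PulseSum

/-- In dimension at least two there are sequences that decay factorially, no two of whose terms
lie on a common line through the origin. -/
theorem exists_seq_pairwise_independent {n : ℕ} (hn : 2 ≤ n) {ε : ℝ} (hε : 0 < ε) :
    ∃ v : ℕ → EuclideanSpace ℝ (Fin n), (∀ k, ‖v k‖ ≤ ε / k.factorial) ∧
      ∀ k j (c : ℝ), c • v k = v j ↔ k = j ∧ c = 1 := by
  set a : ℝ := min ε 1 / 2
  have ha : 0 < a := by positivity
  have haε : a ≤ ε / 2 := by dsimp only [a]; linarith [min_le_left ε 1]
  have ha1 : a ≤ 1 := by dsimp only [a]; linarith [min_le_right ε 1]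
  -- The shift to `(k + 1)!` is needed for injectivity, because `0! = 1!`.
  set d : ℕ → ℝ := fun k => a / (k + 1).factorial
  have hd : ∀ k, 0 < d k := fun k => by dsimp only [d]; positivity
  have hd1 : ∀ k, d k ≤ 1 := fun k => (div_le_one (by positivity)).2
    (ha1.trans (by exact_mod_cast Nat.one_le_iff_ne_zero.2 (Nat.factorial_ne_zero _)))
  have hdk : ∀ k, d k ≤ ε / 2 / k.factorial := fun k => by
    dsimp only [d]
    gcongr
    omega
  have hinj : Function.Injective d := by
    intro k j hkj
    have h : ((k + 1).factorial : ℝ) = (j + 1).factorial :=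
      inv_injective (mul_left_cancel₀ ha.ne' (by simpa only [d, div_eq_mul_inv] using hkj))
    rcases lt_trichotomy k j with h' | h' | h'
    · have := (Nat.factorial_lt k.succ_pos).2 (Nat.succ_lt_succ h')
      exact absurd (Nat.cast_injective h) this.ne
    · exact h'
    · have := (Nat.factorial_lt j.succ_pos).2 (Nat.succ_lt_succ h')
      exact absurd (Nat.cast_injective h) this.ne'
  let i₀ : Fin n := ⟨0, by omega⟩
  let i₁ : Fin n := ⟨1, by omega⟩
  have hi : i₀ ≠ i₁ := by simp [i₀, i₁]
  -- Points of a parabola: a line through the origin meets it in at most one other point.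
  let v : ℕ → EuclideanSpace ℝ (Fin n) := fun k =>
    EuclideanSpace.single i₀ (d k) + EuclideanSpace.single i₁ (d k ^ 2)
  have hv0 : ∀ k, v k i₀ = d k := fun k => by simp [v, hi]
  have hv1 : ∀ k, v k i₁ = d k ^ 2 := fun k => by simp [v, hi.symm]
  refine ⟨v, fun k => ?_, fun k j c => ⟨fun h => ?_, ?_⟩⟩
  · calc ‖v k‖ ≤ ‖EuclideanSpace.single i₀ (d k)‖ + ‖EuclideanSpace.single i₁ (d k ^ 2)‖ :=
          norm_add_le _ _
      _ = d k + d k ^ 2 := by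
          rw [PiLp.norm_single, PiLp.norm_single,
            Real.norm_of_nonneg (hd k).le, Real.norm_of_nonneg (by positivity)]
      _ ≤ d k + d k := by
          gcongr
          rw [sq]
          exact mul_le_of_le_one_left (hd k).le (hd1 k)
      _ ≤ ε / 2 / k.factorial + ε / 2 / k.factorial := add_le_add (hdk k) (hdk k)
      _ = ε / k.factorial := by ring
  · have h0 := congrArg (fun w : EuclideanSpace ℝ (Fin n) => w i₀) h
    have h1 := congrArg (fun w : EuclideanSpace ℝ (Fin n) => w i₁) h
    simp only [PiLp.smul_apply, smul_eq_mul, hv0, hv1] at h0 h1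
    have hkj : d k = d j := by
      apply mul_left_cancel₀ (hd j).ne'
      rw [← sq (d j), ← h1, ← h0]
      ring
    refine ⟨hinj hkj, ?_⟩
    rw [hkj] at h0
    exact mul_right_cancel₀ (hd j).ne' (by rw [h0, one_mul])
  · rintro ⟨rfl, rfl⟩
    exact one_smul _ _

/-! ### Paths drawn in a chart -/

section ChartPath

variable {n : ℕ} {M : Type*} [TopologicalSpace M] [ChartedSpace (EuclideanSpace ℝ (Fin n)) M]

/-- The inverse of the chart at `p`, translated so that it maps `0` to `p`. -/
noncomputable def chartInv (p : M) (w : EuclideanSpace ℝ (Fin n)) : M :=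
  (extChartAt (𝓡 n) p).symm (extChartAt (𝓡 n) p p + w)

/-- The translated chart domain, on which `chartInv p` is a parametrization of `M` near `p`. -/
def chartDomain (p : M) : Set (EuclideanSpace ℝ (Fin n)) :=
  (fun w => extChartAt (𝓡 n) p p + w) ⁻¹' (extChartAt (𝓡 n) p).target

theorem chartInv_zero (p : M) : chartInv (n := n) p 0 = p := by
  rw [chartInv, add_zero, extChartAt_to_inv]

theorem chartInv_injOn (p : M) : InjOn (chartInv (n := n) p) (chartDomain p) := by
  intro x hx y hy h
  exact add_left_cancel ((extChartAt (𝓡 n) p).symm.injOn hx hy h)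

theorem continuousOn_chartInv (p : M) : ContinuousOn (chartInv (n := n) p) (chartDomain p) :=
  (continuousOn_extChartAt_symm p).comp (by fun_prop) fun _ h => h

theorem chartDomain_mem_nhds (p : M) : chartDomain (n := n) p ∈ 𝓝 0 := by
  have h : ContinuousAt (fun w : EuclideanSpace ℝ (Fin n) => extChartAt (𝓡 n) p p + w) 0 := by
    fun_prop
  refine h.preimage_mem_nhds ?_
  rw [add_zero]
  exact extChartAt_target_mem_nhds p

/-- The path in `M` that is given by the curve `g` in the chart at `p`. -/
noncomputable def chartPath (p : M) {x y : M} (g : ℝ → EuclideanSpace ℝ (Fin n))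
    (hg : Continuous g) (hmem : ∀ t, g t ∈ chartDomain p)
    (h0 : chartInv p (g 0) = x) (h1 : chartInv p (g 1) = y) : Path x y where
  toFun t := chartInv p (g t)
  continuous_toFun := (continuousOn_chartInv p).comp_continuous
    (hg.comp continuous_subtype_val) fun t => hmem t
  source' := h0
  target' := h1

variable {p x y : M} {g : ℝ → EuclideanSpace ℝ (Fin n)} {hg : Continuous g}
  {hmem : ∀ t, g t ∈ chartDomain p} {h0 : chartInv p (g 0) = x} {h1 : chartInv p (g 1) = y}

theorem chartPath_apply (t : I) : chartPath p g hg hmem h0 h1 t = chartInv p (g t) := rfl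

theorem chartPath_extend {t : ℝ} (ht : t ∈ Icc (0 : ℝ) 1) :
    (chartPath p g hg hmem h0 h1).extend t = chartInv p (g t) := by
  rw [Path.extend_apply _ ht, chartPath_apply]

theorem isPSPath_chartPath [IsManifold (𝓡 n) ∞ M] (hsm : ContDiff ℝ ∞ g) :
    IsPSPath (𝓡 n) (chartPath p g hg hmem h0 h1) := by
  refine ⟨1, ![0, 1], ?_, rfl, rfl, fun i => ?_⟩
  · rw [Fin.strictMono_iff_lt_succ]
    intro i
    fin_cases i
    simp
  · have hi : Icc (![(0 : ℝ), 1] i.castSucc) (![(0 : ℝ), 1] i.succ) = Icc 0 1 := by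
      fin_cases i
      simp
    rw [hi]
    have hc : ContMDiff 𝓘(ℝ, ℝ) 𝓘(ℝ, EuclideanSpace ℝ (Fin n)) ∞
        (fun t => extChartAt (𝓡 n) p p + g t) := (contDiff_const.add hsm).contMDiff
    have hM : ContMDiff 𝓘(ℝ, ℝ) (𝓡 n) ∞ (fun t => chartInv p (g t)) :=
      (contMDiffOn_extChartAt_symm p).comp_contMDiff hc hmem
    exact hM.contMDiffOn.congr fun t ht => chartPath_extend ht

end ChartPath

end LoopGroup

/-! ### The non-Hausdorff quotient -/

open LoopGroup in
theorem mainTheorem5 (n : ℕ) (hn : 2 ≤ n) (M : Type*) [TopologicalSpace M] [T2Space M]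
    [ChartedSpace (EuclideanSpace ℝ (Fin n)) M] [IsManifold (𝓡 n) ∞ M] (p : M) :
    ¬ T2Space (LoopGroup.LRet (𝓡 n) p) := by
  intro hT2
  obtain ⟨ε, hε, hball⟩ := Metric.nhds_basis_closedBall.mem_iff.1 (chartDomain_mem_nhds (n := n) p)
  obtain ⟨v, hv, hind⟩ := exists_seq_pairwise_independent hn hε
  have hfac : ∀ k m : ℕ, ‖v (k + m)‖ ≤ ε / m.factorial / k.factorial := fun k m => by
    rw [div_div]
    refine (hv _).trans ?_
    gcongr
    rw [mul_comm]
    exact_mod_cast Nat.le_of_dvd (Nat.factorial_pos _) (Nat.factorial_mul_factorial_dvd_factorial_add k m)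
  have hle : ∀ k m : ℕ, ‖v (k + m)‖ ≤ ε / m.factorial := fun k m =>
    (hfac k m).trans (div_le_self (by positivity)
      (by exact_mod_cast Nat.one_le_iff_ne_zero.2 (Nat.factorial_ne_zero _)))
  have hle' : ∀ m : ℕ, ε / m.factorial ≤ ε := fun m => div_le_self hε.le
    (by exact_mod_cast Nat.one_le_iff_ne_zero.2 (Nat.factorial_ne_zero _))
  have hdom : ∀ w : EuclideanSpace ℝ (Fin n), ‖w‖ ≤ ε → w ∈ chartDomain p := fun w hw =>
    hball (mem_closedBall_zero_iff.2 hw)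
  let F : ℕ → ℝ → EuclideanSpace ℝ (Fin n) := fun m => pulseSum fun k => v (k + m)
  have hFs : ∀ m, ContDiff ℝ ∞ (F m) := fun m => contDiff_pulseSum fun k => hfac k m
  have hFn : ∀ m t, ‖F m t‖ ≤ ε / m.factorial := fun m t => norm_pulseSum_le (fun k => hle k m) t
  have hFd : ∀ m t, F m t ∈ chartDomain p := fun m t => hdom _ ((hFn m t).trans (hle' m))
  let L : ℕ → PSLoop (𝓡 n) p := fun m =>
    ⟨chartPath p (F m) (hFs m).continuous (hFd m)
      (by dsimp only [F]; rw [pulseSum_zero, chartInv_zero])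
      (by dsimp only [F]; rw [pulseSum_one, chartInv_zero]), isPSPath_chartPath (hFs m)⟩
  have hL : ∀ m (t : I), (L m).1 t = chartInv p (F m t) := fun m t => rfl
  let c : PSLoop (𝓡 n) p := ⟨chartPath p (fun _ => 0) continuous_const
    (fun _ => hdom _ (by simpa using hε.le)) (chartInv_zero p) (chartInv_zero p),
    isPSPath_chartPath contDiff_const⟩
  have hc : c.1 = Path.refl p := Path.ext (funext fun _ => chartInv_zero p)
  let q : ℕ → M := fun k => chartInv p (v k)
  have hvd : ∀ k, v k ∈ chartDomain p := fun k => hdom _ ((hv k).trans (hle' k))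
  have hq : Function.Injective q := fun k j h =>
    ((hind k j 1).1 (by rw [one_smul]; exact chartInv_injOn p (hvd k) (hvd j) h)).1
  have hqp : ∀ k, q k ≠ p := fun k h => by
    have h0 : v k = 0 := chartInv_injOn p (hvd k) (hdom 0 (by simpa using hε.le))
      (h.trans (chartInv_zero p).symm)
    -- If `v k` were 0, scaling it by 0 would fix it, contrary to `hind`.
    have := ((hind k k 0).1 (by rw [h0, smul_zero])).2
    exact zero_ne_one this
  have hstep : ∀ m, (⟦L m⟧ : LRet (𝓡 n) p) = ⟦L (m + 1)⟧ := by
    intro m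
    -- Halving the time keeps only the outward half of the pulse; by `pulse_one_sub` the return is
    -- its reverse.
    have hgs : ContDiff ℝ ∞ fun t : ℝ => pulse (t / 2) • v m :=
      (contDiff_pulse.comp (contDiff_id.div_const 2)).smul contDiff_const
    let β : Path p (q m) := chartPath p (fun t : ℝ => pulse (t / 2) • v m) hgs.continuous
      (fun t => hdom _ (by
        rw [norm_smul, Real.norm_of_nonneg (pulse_nonneg _)]
        exact (mul_le_of_le_one_left (norm_nonneg _) (pulse_le_one _)).trans
          ((hv m).trans (hle' m))))
      (by rw [zero_div, pulse_of_nonpos le_rfl, zero_smul, chartInv_zero])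
      (by rw [pulse_eq_one_iff.2 rfl, one_smul])
    have hβ : IsPSPath (𝓡 n) β := isPSPath_chartPath hgs
    have hrec : (L m).1 = (β.trans β.symm).trans (L (m + 1)).1 := by
      ext t
      rw [hL, ← Path.extend_extends' (((β.trans β.symm).trans (L (m + 1)).1)) t]
      rcases le_total (t : ℝ) (1 / 2) with ht | ht
      · rw [Path.extend_trans_of_le_half _ _ ht]
        dsimp only [F]
        rw [pulseSum_of_le_half _ ht, zero_add]
        rcases le_total (2 * (t : ℝ)) (1 / 2) with ht' | ht'
        · rw [Path.extend_trans_of_le_half _ _ ht',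
            chartPath_extend ⟨by linarith [t.2.1], by linarith⟩]
          congr 3
          ring
        · rw [Path.extend_trans_of_half_le _ _ ht', Path.extend_symm_apply,
            chartPath_extend ⟨by linarith, by linarith⟩, ← pulse_one_sub]
          congr 3
          ring
      · rw [Path.extend_trans_of_half_le _ _ ht, chartPath_extend ⟨by linarith, by linarith [t.2.2]⟩]
        dsimp only [F]
        rw [pulseSum_of_half_le _ ht]
        congr 3
        ext k
        rw [add_right_comm, add_assoc]
    refine Quotient.sound (Relation.EqvGen.rel _ _ (Or.inr ?_))
    rw [hrec]
    exact IsRetracing.start β _ hβ (L (m + 1)).2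
  have hclass : ∀ m, (⟦L m⟧ : LRet (𝓡 n) p) = ⟦L 0⟧ := by
    intro m
    induction m with
    | zero => rfl
    | succ m ih => rw [← hstep, ih]
  have hlim : Tendsto L atTop (𝓝 c) := by
    rw [tendsto_subtype_rng]
    refine (Topology.IsInducing.induced _).tendsto_nhds_iff.2 ?_
    rw [ContinuousMap.tendsto_nhds_compactOpen]
    intro K _ U hU hKU
    rcases K.eq_empty_or_nonempty with rfl | ⟨t, ht⟩
    · exact Eventually.of_forall fun _ _ h => absurd h (Set.notMem_empty _)
    have hpU : chartInv (n := n) p 0 ∈ U := hKU ht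
    have hcont : ContinuousAt (chartInv (n := n) p) 0 :=
      (continuousOn_chartInv p).continuousAt (chartDomain_mem_nhds p)
    obtain ⟨δ, hδ, hδU⟩ := Metric.nhds_basis_ball.mem_iff.1
      (hcont.preimage_mem_nhds (hU.mem_nhds hpU))
    have hto : Tendsto (fun m : ℕ => ε / m.factorial) atTop (𝓝 0) := by
      have := (FloorSemiring.tendsto_pow_div_factorial_atTop (1 : ℝ)).const_mul ε
      simpa [div_eq_mul_inv] using this
    filter_upwards [hto.eventually_lt_const hδ] with m hm
    intro s _
    -- The bound on `F m` is uniform in time, so the whole of `L m` lies in `U` once `m` is large.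
    exact hδU (mem_ball_zero_iff.2 ((hFn m s).trans_lt hm))
  have hlim' : Tendsto (fun m => (⟦L m⟧ : LRet (𝓡 n) p)) atTop (𝓝 ⟦c⟧) :=
    (continuous_quotient_mk'.tendsto c).comp hlim
  simp only [hclass] at hlim'
  have heq : (⟦L 0⟧ : LRet (𝓡 n) p) = ⟦c⟧ := tendsto_nhds_unique tendsto_const_nhds hlim'
  have hpar := gapParity_eventuallyEq_of_retSetoid hq (Quotient.exact heq)
  have hone : ∀ k, gapParity q (L 0).1 k = 1 := by
    refine gapParity_of_visits (L 0).1 (c := fun j => 1 - 3 / 4 * (1 / 2) ^ j) ?_ ?_ ?_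
    · intro i j hij
      have : (1 / 2 : ℝ) ^ j < (1 / 2) ^ i := pow_lt_pow_right_of_lt_one₀ (by norm_num) (by norm_num) hij
      dsimp only
      linarith
    · intro j
      have h1 : (1 / 2 : ℝ) ^ j ≤ 1 := pow_le_one₀ (by norm_num) (by norm_num)
      have h2 : (0 : ℝ) < (1 / 2) ^ j := by positivity
      constructor <;> linarith
    · intro t ht j
      obtain ⟨k, hk⟩ := exists_forall_pulseSum_eq (E := EuclideanSpace ℝ (Fin n)) t
      rw [← pulseTime_eq_half_iff, ← pulse_eq_one_iff, chartPath_extend ht]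
      constructor
      · intro h
        have h' := chartInv_injOn p (hFd 0 t) (hvd j) h
        dsimp only [F] at h'
        rw [hk] at h'
        -- Independence of the directions means that only the `j`-th excursion reaches `q j`, and
        -- only at its tip.
        obtain ⟨rfl, h''⟩ := (hind _ _ _).1 h'
        exact h''
      · intro h
        dsimp only [F]
        rw [pulseSum_eq_of_ne_zero _ (by rw [h]; exact one_ne_zero), h, one_smul]
        rfl
  obtain ⟨k, hk⟩ := hpar.exists
  rw [hone, hc, gapParity_refl hqp] at hk
  exact one_ne_zero hk
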